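/- \textbf{Setting.} For $p=(r,\theta)$ with $r>0$, $0<\theta<\pi$, let $T^p\subset\mathbb R^2$ be the open triangle with vertices $(0,0)$, $(1,0)$, $(r\cos\theta,r\sin\theta)$. Write $(\cdot,\cdot)_{T^p}$ for the inner product of $L^2(T^p)$ and of $L^2(T^p)^2$. Let $\lambda_1(T)\le\lambda_2(T)\le\cdots$ be the Dirichlet eigenvalues of $T$, counted with multiplicity: $\mu$ is an eigenvalue with eigenfunction $u\in H^1_0(T)\setminus\{0\}$ if $(\nabla u,\nabla v)_T=\mu\,(u,v)_T$ for all $v\in H^1_0(T)$. Let $p=(r,\theta)$ be as above, let $e\in\mathbb R^2$ with $|e|=1$, and let $t>0$ be such that $p_t:=p+te=(r_t,\theta_t)$ also satisfies $r_t>0$, $0<\theta_t<\pi$. Let $$S_t=\begin{pmatrix}1&\dfrac{r_t\cos\theta_t-r\cos\theta}{r\sin\theta}\\[2mm]0&\dfrac{r_t\sin\theta_t}{r\sin\theta}\end{pmatrix},\qquad P^e_t=\frac1t\left(S_t^{-1}S_t^{-\intercal}-I\right),\qquad F_{P^e_t}(u,v)=(P^e_t\nabla u,\nabla v)_{T^p}\quad(u,v\in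 H^1_0(T^p)),$$ so that $\Phi(x)=S_tx$ maps $T^p$ onto $T^{p_t}$. Let $1\le n\le N$ and suppose that $\lambda_n(T^p)=\cdots=\lambda_N(T^p)=:\lambda$. Let $u_n,\dots,u_N\in H^1_0(T^p)$ be $L^2$-orthonormal eigenfunctions for $\lambda$. Put $\lambda_i^t:=\lambda_i(T^{p_t})$ and let $u_n^t,\dots,u_N^t\in H^1_0(T^{p_t})$ be $L^2$-orthonormal eigenfunctions for $\lambda_n^t,\dots,\lambda_N^t$, respectively. Let $\tilde u_i:=u_i^t\circ\Phi\in H^1_0(T^p)$ and let $\tilde u^*_n,\dots,\tilde u^*_N$ be any linearly independent system in $\operatorname{span}\{\tilde u_n,\dots,\tilde u_N\}$ (for instance one of unit vectors chosen close to $u_n,\dots,u_N$). Define the $(N-n+1)\times(N-n+1)$ matrices $M^*_t$ and $N^*_t$, with row index $j$ and column index $i$ ranging over $n,\dots,N$, by $$(M^*_t)_{ji}=F_{P^e_t}(\tilde u^*_i,u_j),\qquad (N^*_t)_{ji}=(\tilde u^*_i,u_j)_{T^p}.$$ \textbf{Lemma.} Each $\tilde u_i$ has a unique representation $\tilde u_i=\sum_{k=n}^N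 s_{ki}\tilde u^*_k$ with $s_{ki}\in\mathbb R$. Let $\sigma_i=(s_{ni},\dots,s_{Ni})^\intercal$ and $\mu_i=(\lambda_i^t-\lambda)/t$. Then, for $i=n,\dots,N$, $$\sigma_i\ne0,\qquad M^*_t\sigma_i=\mu_iN^*_t\sigma_i .$$ Moreover, $\mu_n\le\cdots\le\mu_N$, and $\sigma_n,\dots,\sigma_N$ are linearly independent. If $N^*_t$ is invertible, then $(\mu_i,\sigma_i)$ is the $(i-n+1)$-th eigenpair of the problem $M^*_t\sigma=\mu N^*_t\sigma$; that is, in addition, $\mu_i$ is the $(i-n+1)$-th root of $\det(xN^*_t-M^*_t)$, the roots being listed in nondecreasing order and counted with multiplicity. -/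

import Mathlib

open MeasureTheory Polynomial
open scoped ContDiff ENNReal

noncomputable section

namespace DirichletTriangle

/-! ### Sobolev space with zero boundary values -/

/-- The Euclidean plane. -/
abbrev Plane : Type := EuclideanSpace ℝ (Fin 2)

/-- `L²(Ω; F)` (with Lebesgue measure). -/
abbrev L2 (Ω : Set Plane) (F : Type) [NormedAddCommGroup F] : Type :=
  Lp F 2 ((volume : Measure Plane).restrict Ω)

/-- The pairs `(φ, ∇φ)` in `L²(Ω) × L²(Ω; ℝ²)`, with `φ` smooth with compact support in `Ω`. -/
def testGraph (Ω : Set Plane) : Submodule ℝ (L2 Ω ℝ × L2 Ω Plane) where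
  carrier := {w | ∃ φ : Plane → ℝ, ContDiff ℝ ∞ φ ∧ HasCompactSupport φ ∧ tsupport φ ⊆ Ω ∧
    w.1 =ᵐ[volume.restrict Ω] φ ∧ w.2 =ᵐ[volume.restrict Ω] gradient φ}
  zero_mem' := by
    refine ⟨0, contDiff_const, HasCompactSupport.zero, by simp [tsupport], ?_, ?_⟩
    · exact Lp.coeFn_zero _ _ _
    · have : gradient (0 : Plane → ℝ) = 0 := by
        funext x; simp [gradient]
      rw [this]
      exact Lp.coeFn_zero _ _ _
  add_mem' := by
    rintro v w ⟨φ, h1, h2, h3, h4, h5⟩ ⟨ψ, k1, k2, k3, k4, k5⟩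
    refine ⟨φ + ψ, h1.add k1, h2.add k2,
      (tsupport_add φ ψ).trans (Set.union_subset h3 k3), ?_, ?_⟩
    · filter_upwards [Lp.coeFn_add v.1 w.1, h4, k4] with x hx a b
      simp only [Prod.fst_add, Pi.add_apply] at hx ⊢
      rw [hx, a, b]
    · filter_upwards [Lp.coeFn_add v.2 w.2, h5, k5] with x hx a b
      simp only [Prod.snd_add, Pi.add_apply] at hx ⊢
      rw [hx, a, b]
      have e : fderiv ℝ (φ + ψ) x = fderiv ℝ φ x + fderiv ℝ ψ x :=
        fderiv_add (h1.differentiable (by simp) x) (k1.differentiable (by simp) x)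
      simp [gradient, e]
  smul_mem' := by
    rintro c w ⟨φ, h1, h2, h3, h4, h5⟩
    refine ⟨c • φ, h1.const_smul c, h2.smul_left (f := fun _ => c),
      (tsupport_smul_subset_right (fun _ => c) φ).trans h3, ?_, ?_⟩
    · filter_upwards [Lp.coeFn_smul c w.1, h4] with x hx a
      simp only [Prod.smul_fst, Pi.smul_apply] at hx ⊢
      rw [hx, a]
    · filter_upwards [Lp.coeFn_smul c w.2, h5] with x hx a
      simp only [Prod.smul_snd, Pi.smul_apply] at hx ⊢
      rw [hx, a]
      have e : fderiv ℝ (c • φ) x = c • fderiv ℝ φ x :=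
        fderiv_const_smul (h1.differentiable (by simp) x) c
      simp [gradient, e]

/-- `H¹₀(Ω)`: the closure of the smooth compactly supported functions in the `H¹`-norm. An element
is a pair consisting of an `L²`-function and its (weak) gradient. -/
def H10 (Ω : Set Plane) : Submodule ℝ (L2 Ω ℝ × L2 Ω Plane) := (testGraph Ω).topologicalClosure

variable {Ω Ω' : Set Plane}

/-- The underlying `L²`-function of an element of `H¹₀(Ω)`. -/
def l2val (u : H10 Ω) : L2 Ω ℝ := u.1.1

/-- The gradient of an element of `H¹₀(Ω)`. -/
def weakGrad (u : H10 Ω) : L2 Ω Plane := u.1.2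

/-! ### Dirichlet eigenvalues -/

/-- `u ∈ H¹₀(Ω) \ {0}` and `(∇u, ∇v) = μ (u, v)` for all `v ∈ H¹₀(Ω)`. -/
def IsDirichletEigenfunction (Ω : Set Plane) (μ : ℝ) (u : H10 Ω) : Prop :=
  u ≠ 0 ∧ ∀ v : H10 Ω, inner ℝ (weakGrad u) (weakGrad v) = μ * inner ℝ (l2val u) (l2val v)

/-- The `k`-th Dirichlet eigenvalue (`k = 1, 2, …`), in nondecreasing order and counted with
multiplicity: the least `Λ` such that there are `k` linearly independent eigenfunctions with
eigenvalues `≤ Λ`. -/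
def dirichletEigenvalue (Ω : Set Plane) (k : ℕ) : ℝ :=
  sInf {Λ : ℝ | ∃ u : Fin k → H10 Ω, LinearIndependent ℝ u ∧
    ∀ i, ∃ μ ≤ Λ, IsDirichletEigenfunction Ω μ (u i)}

/-- `L²`-orthonormality of a system in `H¹₀(Ω)`. -/
def L2Orthonormal {ι : Type} (u : ι → H10 Ω) : Prop := Orthonormal ℝ (fun i => l2val (u i))

/-- The form `F_P(u, v) = (P ∇u, ∇v)`. -/
def gradForm (P : Matrix (Fin 2) (Fin 2) ℝ) (u v : H10 Ω) : ℝ :=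
  inner ℝ ((Matrix.toEuclideanCLM (𝕜 := ℝ) P).compLp (weakGrad u)) (weakGrad v)

/-! ### Pullback along a linear isomorphism -/

theorem map_restrict (L : Plane ≃L[ℝ] Plane) (h : L '' Ω = Ω') :
    ∃ c : ℝ≥0∞, c ≠ ⊤ ∧ Measure.map L ((volume : Measure Plane).restrict Ω) =
      c • (volume : Measure Plane).restrict Ω' := by
  have hd : LinearMap.det (L : Plane →ₗ[ℝ] Plane) ≠ 0 := L.toLinearEquiv.isUnit_det'.ne_zero
  have hm : Measure.map L (volume : Measure Plane) =
      ENNReal.ofReal |(LinearMap.det (L : Plane →ₗ[ℝ] Plane))⁻¹| • volume :=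
    Measure.map_linearMap_addHaar_eq_smul_addHaar volume hd
  refine ⟨_, ENNReal.ofReal_ne_top (r := |(LinearMap.det (L : Plane →ₗ[ℝ] Plane))⁻¹|), ?_⟩
  have hΩ : Ω = L ⁻¹' Ω' := by
    rw [← h, Set.preimage_image_eq _ L.injective]
  have he : MeasurableEmbedding L := L.toHomeomorph.measurableEmbedding
  rw [hΩ, ← he.restrict_map, hm, Measure.restrict_smul]

theorem ae_comp {β : Type} (L : Plane ≃L[ℝ] Plane) (h : L '' Ω = Ω') {f g : Plane → β}
    (hfg : f =ᵐ[(volume : Measure Plane).restrict Ω'] g) :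
    (fun x => f (L x)) =ᵐ[(volume : Measure Plane).restrict Ω] fun x => g (L x) := by
  obtain ⟨c, hc, hm⟩ := map_restrict L h
  have : f =ᵐ[Measure.map L ((volume : Measure Plane).restrict Ω)] g := by
    rw [hm]; exact Measure.ae_smul_measure hfg c
  exact ae_of_ae_map L.continuous.measurable.aemeasurable this

section compL2

variable {F : Type} [NormedAddCommGroup F]

theorem memLp_comp (L : Plane ≃L[ℝ] Plane) (h : L '' Ω = Ω') (f : L2 Ω' F) :
    MemLp (fun x => f (L x)) 2 ((volume : Measure Plane).restrict Ω) := by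
  obtain ⟨c, hc, hm⟩ := map_restrict L h
  have := (Lp.memLp f).smul_measure hc
  rw [← hm] at this
  exact this.comp_of_map L.continuous.measurable.aemeasurable

/-- The composition `f ↦ f ∘ L` from `L²(Ω')` to `L²(Ω)`, for `L(Ω) = Ω'`. -/
def compL2 [NormedSpace ℝ F] (L : Plane ≃L[ℝ] Plane) (h : L '' Ω = Ω') :
    L2 Ω' F →ₗ[ℝ] L2 Ω F where
  toFun f := (memLp_comp L h f).toLp _
  map_add' f g := by
    apply Lp.ext
    filter_upwards [MemLp.coeFn_toLp (memLp_comp L h (f + g)), MemLp.coeFn_toLp (memLp_comp L h f),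
      MemLp.coeFn_toLp (memLp_comp L h g), ae_comp L h (Lp.coeFn_add f g),
      Lp.coeFn_add ((memLp_comp L h f).toLp _) ((memLp_comp L h g).toLp _)] with x a b c d e
    rw [a, d, e, Pi.add_apply, Pi.add_apply, b, c]
  map_smul' r f := by
    apply Lp.ext
    filter_upwards [MemLp.coeFn_toLp (memLp_comp L h (r • f)), MemLp.coeFn_toLp (memLp_comp L h f),
      ae_comp L h (Lp.coeFn_smul r f),
      Lp.coeFn_smul r ((memLp_comp L h f).toLp _)] with x a b d e
    rw [a, d, RingHom.id_apply, e, Pi.smul_apply, Pi.smul_apply, b]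

theorem compL2_coe [NormedSpace ℝ F] (L : Plane ≃L[ℝ] Plane) (h : L '' Ω = Ω') (f : L2 Ω' F) :
    compL2 L h f =ᵐ[volume.restrict Ω] fun x => f (L x) :=
  MemLp.coeFn_toLp (memLp_comp L h f)

theorem compL2_continuous [NormedSpace ℝ F] (L : Plane ≃L[ℝ] Plane) (h : L '' Ω = Ω') :
    Continuous (compL2 (F := F) L h) := by
  obtain ⟨c, hc, hm⟩ := map_restrict L h
  refine AddMonoidHomClass.continuous_of_bound (compL2 (F := F) L h)
    ((c ^ (1 / (2 : ℝ≥0∞)).toReal).toReal) fun f => ?_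
  have hs : AEStronglyMeasurable f (Measure.map L ((volume : Measure Plane).restrict Ω)) := by
    rw [hm]; exact (Lp.aestronglyMeasurable f).smul_measure c
  have : eLpNorm (fun x => f (L x)) 2 ((volume : Measure Plane).restrict Ω) =
      c ^ (1 / (2 : ℝ≥0∞)).toReal * eLpNorm f 2 ((volume : Measure Plane).restrict Ω') := by
    have h1 := eLpNorm_map_measure (p := 2) hs L.continuous.measurable.aemeasurable
    rw [hm, eLpNorm_smul_measure_of_ne_top (by simp)] at h1
    simpa [Function.comp_def] using h1.symm
  change ‖(memLp_comp L h f).toLp _‖ ≤ _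
  rw [Lp.norm_toLp, this, ENNReal.toReal_mul, Lp.norm_def]

end compL2

/-- The map `(u, g) ↦ (u ∘ L, Lᵀ (g ∘ L))` on `L²(Ω') × L²(Ω'; ℝ²)`. -/
def pullbackPair (L : Plane ≃L[ℝ] Plane) (h : L '' Ω = Ω') :
    (L2 Ω' ℝ × L2 Ω' Plane) →ₗ[ℝ] (L2 Ω ℝ × L2 Ω Plane) :=
  (compL2 L h).prodMap
    (((ContinuousLinearMap.adjoint (L : Plane →L[ℝ] Plane)).compLpL 2
      ((volume : Measure Plane).restrict Ω) : L2 Ω Plane →ₗ[ℝ] L2 Ω Plane) ∘ₗ compL2 L h)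

theorem pullbackPair_continuous (L : Plane ≃L[ℝ] Plane) (h : L '' Ω = Ω') :
    Continuous (pullbackPair L h) :=
  (compL2_continuous L h).prodMap
    (((ContinuousLinearMap.adjoint (L : Plane →L[ℝ] Plane)).compLpL 2
      ((volume : Measure Plane).restrict Ω)).continuous.comp (compL2_continuous L h))

theorem pullbackPair_mem (L : Plane ≃L[ℝ] Plane) (h : L '' Ω = Ω') :
    ∀ w ∈ H10 Ω', pullbackPair L h w ∈ H10 Ω := by
  intro w hw
  refine map_mem_closure (pullbackPair_continuous L h) hw ?_
  rintro w ⟨φ, h1, h2, h3, h4, h5⟩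
  refine ⟨φ ∘ L, h1.comp L.contDiff, h2.comp_homeomorph L.toHomeomorph, ?_, ?_, ?_⟩
  · have : tsupport (φ ∘ L) = L ⁻¹' tsupport φ := tsupport_comp_eq_preimage φ L.toHomeomorph
    rw [this]
    intro x hx
    have hx' := h3 hx
    rw [← h] at hx'
    exact (L.injective.mem_set_image).1 hx'
  · filter_upwards [compL2_coe L h w.1, ae_comp L h h4] with x a b
    exact a.trans b
  · filter_upwards [compL2_coe L h w.2, ae_comp L h h5,
      ContinuousLinearMap.coeFn_compLpL (p := 2)
        (ContinuousLinearMap.adjoint (L : Plane →L[ℝ] Plane)) (compL2 L h w.2)] with x a b c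
    refine c.trans ?_
    rw [a, b]
    have e : fderiv ℝ (φ ∘ L) x = (fderiv ℝ φ (L x)).comp (L : Plane →L[ℝ] Plane) := by
      rw [fderiv_comp x (h1.differentiable (by simp) _) L.differentiableAt, L.fderiv]
    refine ext_inner_right ℝ fun y => ?_
    rw [ContinuousLinearMap.adjoint_inner_left]
    simp [gradient, e]

/-- The pullback `u ↦ u ∘ L` from `H¹₀(Ω')` to `H¹₀(Ω)`, for a linear isomorphism `L` with
`L(Ω) = Ω'`; gradients transform by the chain rule. -/
def pullback (L : Plane ≃L[ℝ] Plane) (h : L '' Ω = Ω') : H10 Ω' →ₗ[ℝ] H10 Ω :=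
  (pullbackPair L h).restrict (pullbackPair_mem L h)

/-- The pullback of `u` is the function `u ∘ L`. -/
theorem pullback_val (L : Plane ≃L[ℝ] Plane) (h : L '' Ω = Ω') (u : H10 Ω') :
    l2val (pullback L h u) =ᵐ[volume.restrict Ω] fun x => l2val u (L x) :=
  compL2_coe L h u.1.1

/-! ### The family of triangles -/

/-- The admissible parameters `p = (r, θ)`: `r > 0` and `0 < θ < π`. -/
def paramSet : Set Plane := {p | 0 < p 0 ∧ 0 < p 1 ∧ p 1 < Real.pi}

/-- The open triangle `T^p` with vertices `(0, 0)`, `(1, 0)`, `(r cos θ, r sin θ)`,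
for `p = (r, θ)`. -/
def triangle (p : Plane) : Set Plane :=
  interior (convexHull ℝ
    {!₂[(0 : ℝ), 0], !₂[(1 : ℝ), 0], !₂[p 0 * Real.cos (p 1), p 0 * Real.sin (p 1)]})

/-- The matrix `S_{p,q}` of the linear map that takes `T^p` to `T^q`. -/
def transMatrix (p q : Plane) : Matrix (Fin 2) (Fin 2) ℝ :=
  !![1, (q 0 * Real.cos (q 1) - p 0 * Real.cos (p 1)) / (p 0 * Real.sin (p 1));
     0, (q 0 * Real.sin (q 1)) / (p 0 * Real.sin (p 1))]

theorem height_pos {p : Plane} (hp : p ∈ paramSet) : 0 < p 0 * Real.sin (p 1) :=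
  mul_pos hp.1 (Real.sin_pos_of_pos_of_lt_pi hp.2.1 hp.2.2)

theorem transMatrix_isUnit_det {p q : Plane} (hp : p ∈ paramSet) (hq : q ∈ paramSet) :
    IsUnit (transMatrix p q).det := by
  have := height_pos hp
  have := height_pos hq
  rw [isUnit_iff_ne_zero, transMatrix, Matrix.det_fin_two_of]
  simp only [one_mul, mul_zero, sub_zero]
  positivity

/-- The linear isomorphism `Φ_{p,q}` with matrix `S_{p,q}`. -/
def triMap {p q : Plane} (hp : p ∈ paramSet) (hq : q ∈ paramSet) : Plane ≃L[ℝ] Plane :=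
  ContinuousLinearEquiv.equivOfInverse
    (Matrix.toEuclideanCLM (𝕜 := ℝ) (transMatrix p q))
    (Matrix.toEuclideanCLM (𝕜 := ℝ) (transMatrix p q)⁻¹)
    (fun x => by
      rw [← mul_apply_eq_comp, ← map_mul,
        Matrix.nonsing_inv_mul _ (transMatrix_isUnit_det hp hq), map_one]
      rfl)
    (fun x => by
      rw [← mul_apply_eq_comp, ← map_mul,
        Matrix.mul_nonsing_inv _ (transMatrix_isUnit_det hp hq), map_one]
      rfl)

/-- `Φ_{p,q}` maps `T^p` onto `T^q`. -/
theorem triMap_image_triangle {p q : Plane} (hp : p ∈ paramSet) (hq : q ∈ paramSet) :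
    triMap hp hq '' triangle p = triangle q := by
  have hr : p 0 ≠ 0 := hp.1.ne'
  have hs : Real.sin (p 1) ≠ 0 := (Real.sin_pos_of_pos_of_lt_pi hp.2.1 hp.2.2).ne'
  have key : ∀ a b : ℝ, triMap hp hq !₂[a, b] =
      !₂[a + (q 0 * Real.cos (q 1) - p 0 * Real.cos (p 1)) / (p 0 * Real.sin (p 1)) * b,
        (q 0 * Real.sin (q 1)) / (p 0 * Real.sin (p 1)) * b] := by
    intro a b
    change Matrix.toEuclideanCLM (𝕜 := ℝ) (transMatrix p q) !₂[a, b] = _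
    ext i
    fin_cases i <;> simp [transMatrix] <;> ring
  have h1 : ∀ s : Set Plane, triMap hp hq '' (interior s) = interior (triMap hp hq '' s) :=
    (triMap hp hq).toHomeomorph.image_interior
  have h2 : ∀ s : Set Plane,
      triMap hp hq '' (convexHull ℝ s) = convexHull ℝ (triMap hp hq '' s) :=
    ((triMap hp hq).toLinearEquiv : Plane →ₗ[ℝ] Plane).image_convexHull
  rw [triangle, h1, h2, Set.image_insert_eq, Set.image_pair, key, key, key, triangle]
  congr 3
  · simp
  · congr 1
    · simp
    · congr 3
      · field_simp; ring
      · congr 1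
        field_simp

/-- The matrix `P_t^e = (S_t⁻¹ S_t⁻ᵀ - I) / t`, where `S_t` is the matrix of the linear map that
takes `T^p` to `T^{p + t e}`. -/
def diffMatrix (p e : Plane) (t : ℝ) : Matrix (Fin 2) (Fin 2) ℝ :=
  t⁻¹ • ((transMatrix p (p + t • e))⁻¹ * ((transMatrix p (p + t • e))⁻¹).transpose - 1)

/-! ### Generalized matrix eigenvalue problems -/

section Matrices

variable {m : ℕ}

/-- `σ ≠ 0` and `M σ = μ N σ`. -/
def IsGenEigenpair (M N : Matrix (Fin m) (Fin m) ℝ) (μ : ℝ) (σ : Fin m → ℝ) : Prop :=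
  σ ≠ 0 ∧ M.mulVec σ = μ • N.mulVec σ

/-- The polynomial `det (x N - M)`. -/
def pencilPoly (M N : Matrix (Fin m) (Fin m) ℝ) : ℝ[X] :=
  ((X : ℝ[X]) • N.map C - M.map C).det

/-- For invertible `N`: `(μ, σ)` is an eigenpair of `M σ = μ N σ` and `μ` is its `k`-th
eigenvalue (`k = 1, 2, …`), that is, the `k`-th entry in the nondecreasing list of the roots of
`det (x N - M)`, counted with multiplicity. -/
def IsKthGenEigenpair (M N : Matrix (Fin m) (Fin m) ℝ) (k : ℕ) (μ : ℝ) (σ : Fin m → ℝ) : Prop :=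
  IsGenEigenpair M N μ σ ∧ 0 < k ∧ ((pencilPoly M N).roots.sort (· ≤ ·))[k - 1]? = some μ

end Matrices

end DirichletTriangle

end

open DirichletTriangle

namespace DirichletTriangle

/-! ### The Poincaré inequality -/

/-! Pulling the eigenvalue equation on `T^{p_t}` back along `Φ` multiplies both sides by the same
Jacobian factor, so `(S_t⁻¹ S_t⁻ᵀ ∇ũ_i, ∇v) = λ_i^t (ũ_i, v)` for every `v ∈ H¹₀(T^p)`. With `v =
u_j`, subtracting the equation of `u_j` tested with `ũ_i` and dividing by `t` gives `F_P(ũ_i, u_j) =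
μ_i (ũ_i, u_j)` (`gradForm_diffMatrix`). Both sides are linear in `ũ_i`; expanding it in the `ũ*_k`
yields `M σ_i = μ_i N σ_i`.

The pullback is injective, so the `ũ_i` and the `ũ*_k` are bases of one space and the `σ_i` form an
invertible matrix `S`. From `M S = N S diag(μ)`, determinants show that the roots of the pencil are
exactly the `μ_i`, with multiplicity, when `N` is invertible (`pencilPoly_roots_of_mul_eq`).

Poincaré's inequality serves only the ordering of the `μ_i`: eigenvalues are infima, an empty
infimum is `0`, and positivity of the attained eigenvalues rules that case out. -/

/-- Poincaré's inequality on `H¹₀` of a bounded set. -/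
theorem exists_norm_le_norm_snd_of_isBounded {Ω : Set Plane} (hΩ : Bornology.IsBounded Ω) :
    ∃ C : ℝ, ∀ w ∈ H10 Ω, ‖w.1‖ ≤ C * ‖w.2‖ := by
  have hfin : (volume : Measure Plane) Ω ≠ ⊤ := hΩ.measure_lt_top.ne
  -- Gagliardo–Nirenberg–Sobolev in the plane gives `‖φ‖₂ ≤ K ‖∇φ‖₁`, since `2` is conjugate to the
  -- dimension `2`; Hölder on `Ω` gives `‖∇φ‖₁ ≤ V ‖∇φ‖₂` with `V = |Ω|^{1/2}`.
  set K : NNReal := eLpNormLESNormFDerivOneConst (volume : Measure Plane) 2 with hK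
  set V : ℝ≥0∞ := volume Ω ^ (1 / (1 : ℝ≥0∞).toReal - 1 / (2 : ℝ≥0∞).toReal) with hV
  have hVtop : V ≠ ⊤ := ENNReal.rpow_ne_top_of_nonneg (by norm_num) hfin
  refine ⟨(K * V).toReal, fun w hw => ?_⟩
  -- The inequality is a closed condition, so test functions suffice.
  have hclosed : IsClosed {w : L2 Ω ℝ × L2 Ω Plane | ‖w.1‖ ≤ (K * V).toReal * ‖w.2‖} :=
    isClosed_le (by fun_prop) (by fun_prop)
  refine closure_minimal ?_ hclosed hw
  rintro w ⟨φ, h1, h2, h3, h4, h5⟩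
  have hone : ContDiff ℝ 1 φ := h1.of_le (by norm_num)
  have hpq : NNReal.HolderConjugate (Module.finrank ℝ Plane) (2 : NNReal) := by
    rw [finrank_euclideanSpace_fin, NNReal.holderConjugate_iff]
    norm_num
  have hs := eLpNorm_le_eLpNorm_fderiv_one (volume : Measure Plane) hone h2 hpq
  have hgrad : ∀ x, ‖gradient φ x‖ = ‖fderiv ℝ φ x‖ := fun x => by simp [gradient]
  have hsupp : Function.support (gradient φ) ⊆ Ω := by
    intro x hx
    refine h3 (support_fderiv_subset ℝ (f := φ) ?_)
    rw [Function.mem_support] at hx ⊢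
    rwa [← norm_ne_zero_iff, ← hgrad, norm_ne_zero_iff]
  have hsupp' : Function.support φ ⊆ Ω := (subset_tsupport φ).trans h3
  have key : eLpNorm w.1 2 (volume.restrict Ω) ≤
      K * V * eLpNorm w.2 2 (volume.restrict Ω) := by
    calc eLpNorm w.1 2 (volume.restrict Ω) = eLpNorm φ 2 volume := by
          rw [eLpNorm_congr_ae h4, eLpNorm_restrict_eq_of_support_subset hsupp']
      _ ≤ K * eLpNorm (fderiv ℝ φ) 1 volume := by simpa using hs
      _ = K * eLpNorm w.2 1 (volume.restrict Ω) := by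
          rw [eLpNorm_congr_ae h5, eLpNorm_restrict_eq_of_support_subset hsupp]
          congr 1
          exact eLpNorm_congr_norm_ae (.of_forall fun x => (hgrad x).symm)
      _ ≤ K * (eLpNorm w.2 2 (volume.restrict Ω) * V) := by
          gcongr
          simpa [hV] using eLpNorm_le_eLpNorm_mul_rpow_measure_univ
            (μ := (volume : Measure Plane).restrict Ω) (p := 1) (q := 2) (by norm_num)
            (Lp.aestronglyMeasurable w.2)
      _ = K * V * eLpNorm w.2 2 (volume.restrict Ω) := by ring
  change ‖w.1‖ ≤ (K * V).toReal * ‖w.2‖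
  rw [Lp.norm_def, Lp.norm_def, ← ENNReal.toReal_mul]
  exact ENNReal.toReal_mono (ENNReal.mul_ne_top (ENNReal.mul_ne_top ENNReal.coe_ne_top hVtop)
    (Lp.eLpNorm_ne_top _)) key

theorem isBounded_triangle (p : Plane) : Bornology.IsBounded (triangle p) := by
  refine Bornology.IsBounded.subset ?_ interior_subset
  rw [isBounded_convexHull]
  exact (Set.toFinite _).isBounded

/-! ### Dirichlet eigenvalues -/

variable {Ω Ω' : Set Plane}

theorem IsDirichletEigenfunction.nonneg {μ : ℝ} {u : H10 Ω}
    (h : IsDirichletEigenfunction Ω μ u) : 0 ≤ μ := by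
  by_contra! hμ
  have h1 := h.2 u
  have h2 : 0 ≤ inner ℝ (weakGrad u) (weakGrad u) := real_inner_self_nonneg
  have h3 : 0 ≤ inner ℝ (l2val u) (l2val u) := real_inner_self_nonneg
  have h4 : inner ℝ (l2val u) (l2val u) = 0 := by nlinarith
  rw [h4, mul_zero] at h1
  exact h.1 (Subtype.ext (Prod.ext (inner_self_eq_zero.1 h4) (inner_self_eq_zero.1 h1)))

/-- If `μ = 0`, then `∇u = 0`, and Poincaré's inequality forces `u = 0`. -/
theorem IsDirichletEigenfunction.pos (hΩ : Bornology.IsBounded Ω) {μ : ℝ} {u : H10 Ω}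
    (h : IsDirichletEigenfunction Ω μ u) : 0 < μ := by
  refine h.nonneg.lt_of_ne fun h0 => h.1 ?_
  have h1 := h.2 u
  rw [← h0, zero_mul, inner_self_eq_zero] at h1
  obtain ⟨C, hC⟩ := exists_norm_le_norm_snd_of_isBounded hΩ
  have h2 := hC u.1 u.2
  have h3 : u.1.2 = 0 := h1
  rw [h3, norm_zero, mul_zero, norm_le_zero_iff] at h2
  exact Subtype.ext (Prod.ext h2 h3)

/-- Among the eigenvalues that are attained by an eigenfunction, the `k`-th one is monotone
in `k`. -/
theorem dirichletEigenvalue_mono (hΩ : Bornology.IsBounded Ω) {k l : ℕ} (hk : 1 ≤ k) (hkl : k ≤ l)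
    {u : H10 Ω} (hu : IsDirichletEigenfunction Ω (dirichletEigenvalue Ω l) u) :
    dirichletEigenvalue Ω k ≤ dirichletEigenvalue Ω l := by
  have hpos := hu.pos hΩ
  refine csInf_le_csInf ⟨0, ?_⟩ ?_ ?_
  -- The lower bound `0` needs at least one eigenfunction, hence `1 ≤ k`.
  · rintro Λ ⟨v, -, hv⟩
    obtain ⟨μ, hμ, he⟩ := hv ⟨0, hk⟩
    exact he.nonneg.trans hμ
  -- An empty set would give the infimum the default value `0`, but the `l`-th eigenvalue is
  -- positive.
  · by_contra hne
    rw [Set.not_nonempty_iff_eq_empty] at hne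
    rw [dirichletEigenvalue, hne, Real.sInf_empty] at hpos
    exact lt_irrefl _ hpos
  · rintro Λ ⟨v, hv, he⟩
    exact ⟨v ∘ Fin.castLE hkl, hv.comp _ (Fin.castLE_injective hkl), fun i => he _⟩

/-- The map `u ↦ l2val u` as a linear map. -/
noncomputable def l2valₗ (Ω : Set Plane) : H10 Ω →ₗ[ℝ] L2 Ω ℝ :=
  LinearMap.fst ℝ (L2 Ω ℝ) (L2 Ω Plane) ∘ₗ (H10 Ω).subtype

theorem L2Orthonormal.linearIndependent {ι : Type} {u : ι → H10 Ω} (h : L2Orthonormal u) :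
    LinearIndependent ℝ u :=
  LinearIndependent.of_comp (l2valₗ Ω) (Orthonormal.linearIndependent h)

/-! ### The gradient forms -/

/-- The form `F_P(·, v)` as a linear map. -/
noncomputable def gradFormₗ (P : Matrix (Fin 2) (Fin 2) ℝ) (v : H10 Ω) : H10 Ω →ₗ[ℝ] ℝ :=
  (innerₗ (L2 Ω Plane)).flip (weakGrad v) ∘ₗ
    ((Matrix.toEuclideanCLM (𝕜 := ℝ) P).compLpL 2
      ((volume : Measure Plane).restrict Ω) : L2 Ω Plane →ₗ[ℝ] L2 Ω Plane) ∘ₗ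
    LinearMap.snd ℝ (L2 Ω ℝ) (L2 Ω Plane) ∘ₗ (H10 Ω).subtype

theorem gradFormₗ_apply (P : Matrix (Fin 2) (Fin 2) ℝ) (u v : H10 Ω) :
    gradFormₗ P v u = gradForm P u v := rfl

theorem gradForm_add (P Q : Matrix (Fin 2) (Fin 2) ℝ) (u v : H10 Ω) :
    gradForm (P + Q) u v = gradForm P u v + gradForm Q u v := by
  rw [gradForm, map_add, ContinuousLinearMap.add_compLp, inner_add_left]; rfl

theorem gradForm_smul (c : ℝ) (P : Matrix (Fin 2) (Fin 2) ℝ) (u v : H10 Ω) :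
    gradForm (c • P) u v = c * gradForm P u v := by
  rw [gradForm, map_smul, ContinuousLinearMap.smul_compLp, real_inner_smul_left]; rfl

theorem gradForm_one (u v : H10 Ω) : gradForm 1 u v = inner ℝ (weakGrad u) (weakGrad v) := by
  rw [gradForm, map_one]
  congr 1
  apply Lp.ext
  filter_upwards [ContinuousLinearMap.coeFn_compLp (1 : Plane →L[ℝ] Plane) (weakGrad u)] with x hx
  exact hx

/-! ### Pullbacks -/

theorem symm_image (L : Plane ≃L[ℝ] Plane) (h : L '' Ω = Ω') : L.symm '' Ω' = Ω := by
  rw [← h, L.symm_image_image]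

/-- Change of variables. The factor `c` is a parameter so that values and gradients share it and it
cancels in the eigenvalue equation. -/
theorem inner_compL2 {F : Type} [NormedAddCommGroup F] [InnerProductSpace ℝ F]
    (L : Plane ≃L[ℝ] Plane) (h : L '' Ω = Ω') {c : ℝ≥0∞}
    (hm : Measure.map L ((volume : Measure Plane).restrict Ω) =
      c • (volume : Measure Plane).restrict Ω') (f g : L2 Ω' F) :
    inner ℝ (compL2 L h f) (compL2 L h g) = c.toReal * inner ℝ f g := by
  have he : MeasurableEmbedding L := L.toHomeomorph.measurableEmbedding
  rw [L2.inner_def, L2.inner_def, ← smul_eq_mul, ← integral_smul_measure, ← hm, he.integral_map]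
  refine integral_congr_ae ?_
  filter_upwards [compL2_coe L h f, compL2_coe L h g] with x a b
  rw [a, b]

theorem compL2_compL2_symm {F : Type} [NormedAddCommGroup F] [NormedSpace ℝ F]
    (L : Plane ≃L[ℝ] Plane) (h : L '' Ω = Ω') (h' : L.symm '' Ω' = Ω) (f : L2 Ω F) :
    compL2 L h (compL2 L.symm h' f) = f := by
  apply Lp.ext
  filter_upwards [compL2_coe L h (compL2 L.symm h' f), ae_comp L h (compL2_coe L.symm h' f)]
    with x a b
  rw [a, b, L.symm_apply_apply]

theorem weakGrad_pullback (L : Plane ≃L[ℝ] Plane) (h : L '' Ω = Ω') (u : H10 Ω') :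
    weakGrad (pullback L h u) =ᵐ[volume.restrict Ω]
      fun x => ContinuousLinearMap.adjoint (L : Plane →L[ℝ] Plane) (weakGrad u (L x)) := by
  filter_upwards [compL2_coe L h (weakGrad u),
    ContinuousLinearMap.coeFn_compLpL (p := 2)
      (ContinuousLinearMap.adjoint (L : Plane →L[ℝ] Plane)) (compL2 L h (weakGrad u))] with x a b
  rw [← a]
  exact b

/-- Gives surjectivity of the pullback and, with `L` and `L.symm` exchanged, injectivity. -/
theorem pullback_pullback_symm (L : Plane ≃L[ℝ] Plane) (h : L '' Ω = Ω')
    (h' : L.symm '' Ω' = Ω) (u : H10 Ω) : pullback L h (pullback L.symm h' u) = u := by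
  refine Subtype.ext (Prod.ext (compL2_compL2_symm L h h' u.1.1) ?_)
  apply Lp.ext
  filter_upwards [weakGrad_pullback L h (pullback L.symm h' u),
    ae_comp L h (weakGrad_pullback L.symm h' u)] with x a b
  refine a.trans ?_
  rw [b]
  refine ext_inner_right ℝ fun y => ?_
  rw [ContinuousLinearMap.adjoint_inner_left, ContinuousLinearMap.adjoint_inner_left]
  simp [weakGrad]

theorem pullback_injective (L : Plane ≃L[ℝ] Plane) (h : L '' Ω = Ω') :
    Function.Injective (pullback L h) :=
  Function.LeftInverse.injective (g := pullback L.symm (symm_image L h)) fun u =>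
    pullback_pullback_symm L.symm (symm_image L h) h u

/-- If `P = S⁻¹ S⁻ᵀ` for the matrix `S` of `L`, then `F_P` is, up to the Jacobian, the Dirichlet
form of the image domain. -/
theorem gradForm_pullback (L : Plane ≃L[ℝ] Plane) (h : L '' Ω = Ω') {c : ℝ≥0∞}
    (hm : Measure.map L ((volume : Measure Plane).restrict Ω) =
      c • (volume : Measure Plane).restrict Ω') (S : Matrix (Fin 2) (Fin 2) ℝ)
    (hS : Matrix.toEuclideanCLM (𝕜 := ℝ) S = (L.symm : Plane →L[ℝ] Plane)) (u v : H10 Ω') :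
    gradForm (S * S.transpose) (pullback L h u) (pullback L h v) =
      c.toReal * inner ℝ (weakGrad u) (weakGrad v) := by
  rw [← inner_compL2 L h hm, gradForm, L2.inner_def, L2.inner_def]
  refine integral_congr_ae ?_
  -- `S` here is the matrix of `L⁻¹`, so `S Sᵀ` acts as `L⁻¹ L⁻*`; it cancels against the two
  -- factors `L*` from the chain rule.
  have hadj : Matrix.toEuclideanCLM (𝕜 := ℝ) S.transpose =
      ContinuousLinearMap.adjoint (L.symm : Plane →L[ℝ] Plane) := by
    rw [← hS, ← ContinuousLinearMap.star_eq_adjoint, ← map_star, Matrix.star_eq_conjTranspose,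
      Matrix.conjTranspose_eq_transpose_of_trivial]
  filter_upwards [weakGrad_pullback L h u, weakGrad_pullback L h v,
    compL2_coe L h (weakGrad u), compL2_coe L h (weakGrad v),
    ContinuousLinearMap.coeFn_compLp (Matrix.toEuclideanCLM (𝕜 := ℝ) (S * S.transpose))
      (weakGrad (pullback L h u))] with x a b d e f
  rw [f, a, b, d, e, map_mul, hS, hadj, mul_apply_eq_comp,
    ContinuousLinearMap.adjoint_inner_right]
  set g := weakGrad u (L x)
  have hg : ContinuousLinearMap.adjoint (L.symm : Plane →L[ℝ] Plane)
      (ContinuousLinearMap.adjoint (L : Plane →L[ℝ] Plane) g) = g := by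
    refine ext_inner_right ℝ fun y => ?_
    rw [ContinuousLinearMap.adjoint_inner_left, ContinuousLinearMap.adjoint_inner_left]
    simp
  rw [hg]
  simp

/-- The eigenvalue equation on the image domain, tested with functions on the original one. -/
theorem IsDirichletEigenfunction.gradForm_pullback (L : Plane ≃L[ℝ] Plane) (h : L '' Ω = Ω')
    (S : Matrix (Fin 2) (Fin 2) ℝ)
    (hS : Matrix.toEuclideanCLM (𝕜 := ℝ) S = (L.symm : Plane →L[ℝ] Plane)) {μ : ℝ} {u : H10 Ω'}
    (hu : IsDirichletEigenfunction Ω' μ u) (v : H10 Ω) :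
    gradForm (S * S.transpose) (pullback L h u) v =
      μ * inner ℝ (l2val (pullback L h u)) (l2val v) := by
  obtain ⟨c, -, hm⟩ := map_restrict L h
  -- Every test function on `Ω` is a pullback, so the equation on `Ω'` can be used with `w`.
  obtain ⟨w, rfl⟩ : ∃ w, pullback L h w = v :=
    ⟨_, pullback_pullback_symm L h (symm_image L h) v⟩
  have hval : inner ℝ (l2val (pullback L h u)) (l2val (pullback L h w)) =
      c.toReal * inner ℝ (l2val u) (l2val w) := inner_compL2 L h hm _ _
  rw [DirichletTriangle.gradForm_pullback L h hm S hS, hu.2 w, hval]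
  ring

/-- The difference quotient of the eigenvalue equations on `T^{p + t e}` and on `T^p`. -/
theorem gradForm_diffMatrix {p e : Plane} {t : ℝ} (ht : t ≠ 0) (hp : p ∈ paramSet)
    (hpt : p + t • e ∈ paramSet) {lam μ : ℝ} {u : H10 (triangle p)}
    (hu : IsDirichletEigenfunction (triangle p) lam u) {v : H10 (triangle (p + t • e))}
    (hv : IsDirichletEigenfunction (triangle (p + t • e)) μ v) :
    gradForm (diffMatrix p e t)
        (pullback (triMap hp hpt) (triMap_image_triangle hp hpt) v) u =
      (μ - lam) / t * inner ℝ
        (l2val (pullback (triMap hp hpt) (triMap_image_triangle hp hpt) v)) (l2val u) := by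
  set S := (transMatrix p (p + t • e))⁻¹ with hS
  set w := pullback (triMap hp hpt) (triMap_image_triangle hp hpt) v
  have h1 : gradForm (S * S.transpose) w u = μ * inner ℝ (l2val w) (l2val u) :=
    hv.gradForm_pullback (triMap hp hpt) (triMap_image_triangle hp hpt) S rfl u
  -- The equation of `u` tested with `w`, read through the symmetry of both inner products.
  have h2 : gradForm 1 w u = lam * inner ℝ (l2val w) (l2val u) := by
    rw [gradForm_one, real_inner_comm, hu.2 w, real_inner_comm]
  have h3 : t • diffMatrix p e t + 1 = S * S.transpose := by
    rw [diffMatrix, smul_inv_smul₀ ht, sub_add_cancel]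
  rw [← h3, gradForm_add, gradForm_smul, h2] at h1
  field_simp
  linarith

/-! ### Matrix pencils -/

/-- Over `ℝ[X]`, `(X N - M) S = N S (X - diag μ)`; take determinants and cancel `det S`. -/
theorem pencilPoly_roots_of_mul_eq {m : ℕ} {M N S : Matrix (Fin m) (Fin m) ℝ} {μ : Fin m → ℝ}
    (hS : S.det ≠ 0) (hN : N.det ≠ 0) (h : M * S = N * S * Matrix.diagonal μ) :
    (pencilPoly M N).roots = Multiset.map μ Finset.univ.val := by
  have h1 : ((X : ℝ[X]) • N.map C - M.map C) * S.map C =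
      (N * S).map C * Matrix.diagonal fun i => X - C (μ i) := by
    have h2 : M.map C * S.map C = N.map C * S.map C * Matrix.diagonal fun i => C (μ i) := by
      rw [← Matrix.map_mul, h, Matrix.map_mul, Matrix.map_mul, Matrix.diagonal_map (map_zero C)]
    have h3 : (Matrix.diagonal fun i => X - C (μ i)) =
        (X : ℝ[X]) • (1 : Matrix (Fin m) (Fin m) ℝ[X]) - Matrix.diagonal fun i => C (μ i) := by
      rw [Matrix.smul_one_eq_diagonal, Matrix.diagonal_sub]
    rw [Matrix.sub_mul, h2, h3, Matrix.mul_sub, Matrix.map_mul, Matrix.mul_smul, Matrix.mul_one,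
      Matrix.smul_mul]
  have hdet : ∀ A : Matrix (Fin m) (Fin m) ℝ, (A.map C).det = C A.det := fun A =>
    (RingHom.map_det C A).symm
  have h4 := congrArg Matrix.det h1
  rw [Matrix.det_mul, Matrix.det_mul, Matrix.det_diagonal, hdet, hdet, Matrix.det_mul] at h4
  have h5 : pencilPoly M N = C N.det * ∏ i, (X - C (μ i)) := by
    have hC : (C S.det : ℝ[X]) ≠ 0 := by simpa using hS
    refine mul_right_cancel₀ hC ?_
    rw [pencilPoly, h4, C_mul]
    ring
  rw [h5, roots_C_mul _ hN]
  have h6 := roots_multiset_prod_X_sub_C (Multiset.map μ Finset.univ.val)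
  rwa [Multiset.map_map] at h6

theorem sort_map_univ_of_monotone {m : ℕ} {μ : Fin m → ℝ} (hμ : Monotone μ) :
    (Multiset.map μ Finset.univ.val).sort (· ≤ ·) = List.ofFn μ := by
  have h : Multiset.map μ Finset.univ.val = (List.ofFn μ : Multiset ℝ) := by
    rw [Fin.univ_val_map]
  rw [h, Multiset.coe_sort]
  exact List.mergeSort_eq_self _ (List.sortedLE_ofFn_iff.2 hμ).pairwise

/-- The independent `σ i` are the columns of an invertible matrix, so repeated values of `μ` are
counted correctly; monotonicity makes `List.ofFn μ` the sorted list of roots. -/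
theorem isKthGenEigenpair_of_monotone {m : ℕ} {M N : Matrix (Fin m) (Fin m) ℝ} {μ : Fin m → ℝ}
    {σ : Fin m → Fin m → ℝ} (hN : N.det ≠ 0) (hμ : Monotone μ) (hσ : LinearIndependent ℝ σ)
    (h : ∀ i, IsGenEigenpair M N (μ i) (σ i)) (i : Fin m) :
    IsKthGenEigenpair M N ((i : ℕ) + 1) (μ i) (σ i) := by
  refine ⟨h i, Nat.succ_pos _, ?_⟩
  have hS : ((Matrix.of σ).transpose).det ≠ 0 := by
    rw [Matrix.det_transpose, ← isUnit_iff_ne_zero, ← Matrix.isUnit_iff_isUnit_det,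
      ← Matrix.linearIndependent_rows_iff_isUnit]
    exact hσ
  have hmul : M * (Matrix.of σ).transpose =
      N * (Matrix.of σ).transpose * Matrix.diagonal μ := by
    ext j k
    rw [Matrix.mul_diagonal]
    have h1 := congrFun (h k).2 j
    rw [Pi.smul_apply, smul_eq_mul, mul_comm] at h1
    exact h1
  rw [pencilPoly_roots_of_mul_eq hS hN hmul, sort_map_univ_of_monotone hμ]
  simp

end DirichletTriangle

/-! ### The eigenpairs of the pencil -/

theorem mainTheorem2
    (p e : Plane) (t : ℝ) (he : ‖e‖ = 1) (ht : 0 < t)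
    (hp : p ∈ paramSet) (hpt : p + t • e ∈ paramSet)
    (n N : ℕ) (hn : 1 ≤ n) (hnN : n ≤ N)
    (lam : ℝ) (hlam : ∀ k, n ≤ k → k ≤ N → dirichletEigenvalue (triangle p) k = lam)
    (u : Fin (N - n + 1) → H10 (triangle p))
    (hu : ∀ i, IsDirichletEigenfunction (triangle p) lam (u i))
    (hu_on : L2Orthonormal u)
    (ut : Fin (N - n + 1) → H10 (triangle (p + t • e)))
    (hut : ∀ i : Fin (N - n + 1), IsDirichletEigenfunction (triangle (p + t • e))
      (dirichletEigenvalue (triangle (p + t • e)) (n + i)) (ut i))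
    (hut_on : L2Orthonormal ut)
    (util : Fin (N - n + 1) → H10 (triangle p))
    (hutil : ∀ i, util i = pullback (triMap hp hpt) (triMap_image_triangle hp hpt) (ut i))
    (ustar : Fin (N - n + 1) → H10 (triangle p))
    (hustar_mem : ∀ i, ustar i ∈ Submodule.span ℝ (Set.range util))
    (hustar_li : LinearIndependent ℝ ustar)
    (Mt Nt : Matrix (Fin (N - n + 1)) (Fin (N - n + 1)) ℝ)
    (hMt : Mt = Matrix.of fun j i => gradForm (diffMatrix p e t) (ustar i) (u j))
    (hNt : Nt = Matrix.of fun j i => inner ℝ (l2val (ustar i)) (l2val (u j)))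
    (mu : Fin (N - n + 1) → ℝ)
    (hmu : ∀ i : Fin (N - n + 1),
      mu i = (dirichletEigenvalue (triangle (p + t • e)) (n + i) - lam) / t) :
    ∃ σ : Fin (N - n + 1) → Fin (N - n + 1) → ℝ,
      (∀ i, util i = ∑ k, σ i k • ustar k) ∧
      (∀ σ' : Fin (N - n + 1) → Fin (N - n + 1) → ℝ,
        (∀ i, util i = ∑ k, σ' i k • ustar k) → σ' = σ) ∧
      (∀ i, IsGenEigenpair Mt Nt (mu i) (σ i)) ∧
      Monotone mu ∧
      LinearIndependent ℝ σ ∧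
      (Nt.det ≠ 0 → ∀ i : Fin (N - n + 1),
        IsKthGenEigenpair Mt Nt ((i : ℕ) + 1) (mu i) (σ i)) := by
  have hut_li : LinearIndependent ℝ util := by
    have h := hut_on.linearIndependent.map'
      (pullback (triMap hp hpt) (triMap_image_triangle hp hpt))
      (LinearMap.ker_eq_bot.2 (pullback_injective _ _))
    rwa [show util = pullback (triMap hp hpt) (triMap_image_triangle hp hpt) ∘ ut from
      funext hutil]
  -- Inclusion together with equal dimension.
  have hspan : Submodule.span ℝ (Set.range ustar) = Submodule.span ℝ (Set.range util) := by
    have := FiniteDimensional.span_of_finite ℝ (Set.finite_range util)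
    refine Submodule.eq_of_le_of_finrank_eq ?_ ?_
    · rw [Submodule.span_le]
      rintro _ ⟨i, rfl⟩
      exact hustar_mem i
    · rw [finrank_span_eq_card hustar_li, finrank_span_eq_card hut_li]
  have hex : ∀ i, ∃ c : Fin (N - n + 1) → ℝ, ∑ k, c k • ustar k = util i := fun i => by
    rw [← Submodule.mem_span_range_iff_exists_fun, hspan]
    exact Submodule.subset_span ⟨i, rfl⟩
  choose σ hσ using hex
  have hσ_li : LinearIndependent ℝ σ := by
    -- The map `c ↦ ∑ c_k ũ*_k` sends the `σ i` to the independent `util i`.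
    refine LinearIndependent.of_comp (Fintype.linearCombination ℝ ustar) ?_
    rwa [show Fintype.linearCombination ℝ ustar ∘ σ = util from funext hσ]
  have hmono : Monotone mu := by
    intro i j hij
    rw [hmu, hmu]
    -- The eigenfunction `ut j` shows that the larger eigenvalue is attained.
    have := dirichletEigenvalue_mono (isBounded_triangle _) (k := n + i) (l := n + j) (by omega)
      (by have := Fin.le_def.1 hij; omega) (hut j)
    gcongr
  have hpair : ∀ i, IsGenEigenpair Mt Nt (mu i) (σ i) := by
    refine fun i => ⟨hσ_li.ne_zero i, ?_⟩
    ext j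
    have hM : Mt.mulVec (σ i) j = gradForm (diffMatrix p e t) (util i) (u j) := by
      rw [← gradFormₗ_apply, ← hσ i, map_sum, hMt]
      simp [Matrix.mulVec, dotProduct, gradFormₗ_apply, mul_comm]
    have hN : Nt.mulVec (σ i) j = inner ℝ (l2val (util i)) (l2val (u j)) := by
      change _ = inner ℝ (l2valₗ _ (util i)) (l2val (u j))
      rw [← hσ i, map_sum, sum_inner, hNt]
      simp only [Matrix.mulVec, dotProduct, Matrix.of_apply, map_smul, real_inner_smul_left]
      exact Finset.sum_congr rfl fun k _ => mul_comm _ _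
    rw [hM, Pi.smul_apply, hN, hmu, hutil, smul_eq_mul]
    exact gradForm_diffMatrix ht.ne' hp hpt (hu j) (hut i)
  refine ⟨σ, fun i => (hσ i).symm, fun σ' hσ' => ?_, hpair, hmono, hσ_li, fun hdet =>
    isKthGenEigenpair_of_monotone hdet hmono hσ_li hpair⟩
  funext i
  refine hustar_li.fintypeLinearCombination_injective ?_
  exact (hσ' i).symm.trans (hσ i).symm
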